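/- **Setting.** Let $K,m,T\ge 1$ be integers with $K\le T$, and write $[n]=\{1,\dots,n\}$. Let $\Delta_K$ be the probability simplex in $\mathbb R^K$, let $\alpha_1,\dots,\alpha_m\in[0,1]$ be thresholds, and let $\mathcal G_1,\dots,\mathcal G_m$ be probability distributions on $[0,1]^K$ with means $\boldsymbol g_i=\mathbb E_{\boldsymbol g\sim\mathcal G_i}[\boldsymbol g]$. Assume that the constraints are feasible: there is $\boldsymbol x\in\Delta_K$ with $\boldsymbol g_i^\top\boldsymbol x\le\alpha_i$ for all $i\in[m]$. In each round $t\in[T]$ the learner has a strategy $\boldsymbol x_t\in\Delta_K$; an adaptive adversary, knowing the past rounds, chooses a loss vector $\boldsymbol\ell_t\in[0,1]^K$; an action $a_t$ is drawn from $\boldsymbol x_t$ given the past; and cost vectors $\boldsymbol g_{t,i}$ with law $\mathcal G_i$, $i\in[m]$, are drawn independently of the past and of $a_t$. The learner observes $\ell_t(a_t)$ and $g_{t,i}(a_t)$ for $i\in[m]$. The cumulative positive constraint violation is $$V_T=\max_{i\in[m]}\sum_{t=1}^T\max\{0,\ \boldsymbol g_i^\top\boldsymbol x_t-\alpha_i\}.$$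 **The algorithm COLB.** Inputs: a learning rate $\eta>0$, a confidence $\delta\in(0,1)$, and the thresholds $\alpha_i$. Put $\kappa=e^{1/\ln T}$ (if $T=1$, put $\kappa=1$; this value plays no role), $\boldsymbol x_1=\frac1K\boldsymbol 1$, $h_{1,a}=2K$ and $\eta_{1,a}=\eta$ for all $a\in[K]$. For $t\in[T]$, after round $t$ has been played, let $N_t(a)=|\{\tau\le t: a_\tau=a\}|$, $$\widehat g_{t,i}(a)=\frac{\sum_{\tau\le t}g_{\tau,i}(a)\mathbf 1\{a_\tau=a\}}{\max\{1,N_t(a)\}},\qquad \beta_t(a)=\min\left\{1,\sqrt{\frac{4\ln(TKm/\delta)}{\max\{1,N_t(a)\}}}\right\},$$ $$\Omega=\{\boldsymbol x\in\Delta_K: x(a)\ge \tfrac1T\ \ \forall a\},\qquad \widetilde{\mathcal S}_t=\{\boldsymbol x\in\Omega: (\widehat{\boldsymbol g}_{t,i}-\boldsymbol\beta_t)^\top\boldsymbol x\le\alpha_i+\tfrac KT\ \ \forall i\in[m]\}.$$ * If $\widetilde{\mathcal S}_t\ne\emptyset$, then, with $\widehat\ell_t(a)=\ell_t(a)\mathbf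 1\{a_t=a\}/x_t(a)$ and $\psi_t(\boldsymbol x)=\sum_{a}\frac1{\eta_{t,a}}\ln\frac1{x(a)}$, $$\boldsymbol x_{t+1}=\operatorname*{arg\,min}_{\boldsymbol x\in\widetilde{\mathcal S}_t}\ \widehat{\boldsymbol\ell}_t^\top\boldsymbol x+D_{\psi_t}(\boldsymbol x,\boldsymbol x_t),$$ where $D_\psi(\boldsymbol x,\boldsymbol y)=\psi(\boldsymbol x)-\psi(\boldsymbol y)-\nabla\psi(\boldsymbol y)^\top(\boldsymbol x-\boldsymbol y)$. For each $a$: if $1/x_{t+1}(a)>h_{t,a}$, set $h_{t+1,a}=2/x_{t+1}(a)$ and $\eta_{t+1,a}=\kappa\,\eta_{t,a}$; otherwise set $h_{t+1,a}=h_{t,a}$ and $\eta_{t+1,a}=\eta_{t,a}$. * If $\widetilde{\mathcal S}_t=\emptyset$, then $\boldsymbol x_{t+1}$ is an arbitrary, possibly random, element of $\Omega$, selected without knowledge of the future, and $h_{t+1,a}=h_{t,a}$, $\eta_{t+1,a}=\eta_{t,a}$. **Theorem (violations of COLB).** There is an absolute constant $C>0$ such that for all $K,m,T$, $\delta$, $\eta$,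 $\alpha_i$, $\mathcal G_i$ as above and every adaptive adversary, with probability at least $1-2\delta$, $$V_T\le C\sqrt{KT\ln\left(\frac{TKm}{\delta}\right)}.$$ -/

import Mathlib

open MeasureTheory ProbabilityTheory

namespace COLB

noncomputable section

/-! Rounds are numbered `1, …, T`, actions are the elements of `Fin K` and constraints the elements
of `Fin m`.  Round-indexed sequences are functions on `ℕ`; only the entries that belong to the
rounds `1, …, T` are ever constrained. -/

/-! ### The setting -/

/-- The expected cost `g_i(b)` of action `b` for constraint `i`, where the cost vector of
constraint `i` has law `G i`. -/
def meanCost {K m : ℕ} (G : Fin m → Measure (Fin K → ℝ)) (i : Fin m) (b : Fin K) : ℝ :=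
  ∫ v, v b ∂(G i)

/-- The strategy `x` satisfies all the constraints in expectation. -/
def IsFeasible {K m : ℕ} (G : Fin m → Measure (Fin K → ℝ)) (α : Fin m → ℝ)
    (x : Fin K → ℝ) : Prop :=
  x ∈ stdSimplex ℝ (Fin K) ∧ ∀ i, ∑ b, meanCost G i b * x b ≤ α i

/-- The cumulative positive constraint violation
`V_T = max_i ∑_{t=1}^T [g_iᵀ x_t - α_i]⁺` of a sequence of strategies. -/
def violation {K m : ℕ} (G : Fin m → Measure (Fin K → ℝ)) (α : Fin m → ℝ) (T : ℕ)
    (x : ℕ → Fin K → ℝ) : ℝ :=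
  ⨆ i : Fin m, ∑ t ∈ Finset.Icc 1 T, max 0 (∑ b, meanCost G i b * x t b - α i)

/-- The interaction protocol over `T` rounds, on a probability space `(Ω, P)`.
The σ-algebra `ℱ t` is the information present in round `t` just before the action is drawn:
it contains the history of the rounds before `t` (actions, losses, costs), the strategy `x t`, the
loss vector `ℓ t`, and possibly private randomness used so far by the adversary and the learner. -/
structure IsInteraction {K m : ℕ} {Ω : Type*} [mΩ : MeasurableSpace Ω] (P : Measure Ω)
    (T : ℕ) (G : Fin m → Measure (Fin K → ℝ)) (ℱ : Filtration ℕ mΩ)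
    (x : ℕ → Ω → Fin K → ℝ) (a : ℕ → Ω → Fin K) (ℓ : ℕ → Ω → Fin K → ℝ)
    (g : ℕ → Ω → Fin m → Fin K → ℝ) : Prop where
  /-- The strategy is fixed before the action is drawn. -/
  strategy_adapted : ∀ t ∈ Finset.Icc 1 T, Measurable[ℱ t] (x t)
  /-- The adversary chooses the loss vector as a function of the past. -/
  loss_adapted : ∀ t ∈ Finset.Icc 1 T, Measurable[ℱ t] (ℓ t)
  loss_mem : ∀ t ∈ Finset.Icc 1 T, ∀ ω b, ℓ t ω b ∈ Set.Icc (0 : ℝ) 1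
  /-- Action and costs of round `t` belong to the history from round `t + 1` on. -/
  action_adapted : ∀ t ∈ Finset.Icc 1 T, Measurable[ℱ (t + 1)] (a t)
  cost_adapted : ∀ t ∈ Finset.Icc 1 T, Measurable[ℱ (t + 1)] (g t)
  /-- Given the past, the action `a t` is drawn from the strategy `x t`. -/
  action_law : ∀ t ∈ Finset.Icc 1 T, ∀ b,
    P[({ω | a t ω = b}).indicator (fun _ => (1 : ℝ)) | ℱ t] =ᵐ[P] fun ω => x t ω b
  /-- The cost vector of constraint `i` is drawn from `G i` in every round … -/
  cost_law : ∀ t ∈ Finset.Icc 1 T, ∀ i, P.map (fun ω => g t ω i) = G i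
  /-- … independently of the past and of the action of the round. -/
  cost_indep : ∀ t ∈ Finset.Icc 1 T,
    Indep (MeasurableSpace.comap (g t) inferInstance)
      (ℱ t ⊔ MeasurableSpace.comap (a t) inferInstance) P

/-! ### Cost estimates and decision spaces -/

/-- `N_t(b)`, the number of rounds up to `t` in which action `b` is played. -/
def playCount {K : ℕ} (a : ℕ → Fin K) (t : ℕ) (b : Fin K) : ℕ :=
  ((Finset.Icc 1 t).filter (fun τ => a τ = b)).card

/-- The empirical mean `ĝ_{t,i}(b)` of the observed costs. -/
def costEstimate {K m : ℕ} (a : ℕ → Fin K) (g : ℕ → Fin m → Fin K → ℝ) (t : ℕ)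
    (i : Fin m) (b : Fin K) : ℝ :=
  (1 / max 1 (playCount a t b : ℝ)) * ∑ τ ∈ Finset.Icc 1 t, if a τ = b then g τ i b else 0

/-- The confidence width `β_t(b) = min {1, √(4 ln(TKm/δ) / max {1, N_t(b)})}`. -/
def confWidth {K : ℕ} (m T : ℕ) (δ : ℝ) (a : ℕ → Fin K) (t : ℕ) (b : Fin K) : ℝ :=
  min 1 (√(4 * Real.log ((T : ℝ) * K * m / δ) / max 1 (playCount a t b : ℝ)))

/-- The truncated simplex `{x ∈ Δ_K : x(b) ≥ 1/T for all b}`. -/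
def truncatedSimplex (K T : ℕ) : Set (Fin K → ℝ) :=
  {x | x ∈ stdSimplex ℝ (Fin K) ∧ ∀ b, 1 / (T : ℝ) ≤ x b}

/-- The relaxed safe decision space
`{x ∈ Δ_K : (ĝ_{t,i} - β_t)ᵀ x ≤ α_i + K/T for all i}`. -/
def safeSpace {K m : ℕ} (T : ℕ) (δ : ℝ) (α : Fin m → ℝ) (a : ℕ → Fin K)
    (g : ℕ → Fin m → Fin K → ℝ) (t : ℕ) : Set (Fin K → ℝ) :=
  {x | x ∈ stdSimplex ℝ (Fin K) ∧
    ∀ i, ∑ b, (costEstimate a g t i b - confWidth m T δ a t b) * x b ≤ α i + (K : ℝ) / T}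

/-- The truncated safe decision space of round `t`. -/
def truncatedSafeSpace {K m : ℕ} (T : ℕ) (δ : ℝ) (α : Fin m → ℝ) (a : ℕ → Fin K)
    (g : ℕ → Fin m → Fin K → ℝ) (t : ℕ) : Set (Fin K → ℝ) :=
  truncatedSimplex K T ∩ safeSpace T δ α a g t

/-! ### Online mirror descent with log-barrier -/

/-- The importance-weighted loss estimate `ℓ̂(b) = ℓ(b) 1{a = b} / x(b)`. -/
def lossEstimate {K : ℕ} (x : Fin K → ℝ) (a : Fin K) (ℓ : Fin K → ℝ) (b : Fin K) : ℝ :=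
  if a = b then ℓ b / x b else 0

/-- The log-barrier `ψ(x) = ∑_b (1/η_b) ln(1/x(b))`. -/
def logBarrier {K : ℕ} (η : Fin K → ℝ) (x : Fin K → ℝ) : ℝ :=
  ∑ b, (1 / η b) * Real.log (1 / x b)

/-- The Bregman divergence `D_ψ(x, y) = ψ(x) - ψ(y) - ∇ψ(y)ᵀ (x - y)`. -/
def bregman {K : ℕ} (ψ : (Fin K → ℝ) → ℝ) (x y : Fin K → ℝ) : ℝ :=
  ψ x - ψ y - fderiv ℝ ψ y (x - y)

/-- The objective `ℓ̂_tᵀ y + D_{ψ_t}(y, x_t)` of the mirror descent step, as a function of `y`. -/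
def omdObjective {K : ℕ} (η : Fin K → ℝ) (x : Fin K → ℝ) (a : Fin K) (ℓ : Fin K → ℝ)
    (y : Fin K → ℝ) : ℝ :=
  ∑ b, lossEstimate x a ℓ b * y b + bregman (logBarrier η) y x

/-! ### The algorithm -/

/-- One trajectory of the algorithm with horizon `T`, learning rate `η₀`, confidence `δ` and
thresholds `α`: strategies `x t`, thresholds `h t` and learning rates `η t`, produced in response to
the actions `a t`, losses `ℓ t` and costs `g t` (used only through `ℓ t (a t)` and
`g t i (a t)`). In the rounds with empty truncated safe space, the strategy may be any element of
the truncated simplex, selected in any way. -/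
structure IsTrajectory {K m : ℕ} (T : ℕ) (η₀ δ : ℝ) (α : Fin m → ℝ)
    (x : ℕ → Fin K → ℝ) (h η : ℕ → Fin K → ℝ)
    (a : ℕ → Fin K) (ℓ : ℕ → Fin K → ℝ) (g : ℕ → Fin m → Fin K → ℝ) : Prop where
  init_strategy : ∀ b, x 1 b = 1 / (K : ℝ)
  init_threshold : ∀ b, h 1 b = 2 * (K : ℝ)
  init_rate : ∀ b, η 1 b = η₀
  /-- The mirror descent step, when the truncated safe space is not empty. -/
  step_omd : ∀ t ∈ Finset.Icc 1 T, (truncatedSafeSpace T δ α a g t).Nonempty →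
    (x (t + 1) ∈ truncatedSafeSpace T δ α a g t ∧
      IsMinOn (omdObjective (η t) (x t) (a t) (ℓ t)) (truncatedSafeSpace T δ α a g t)
        (x (t + 1))) ∧
    (∀ b, h t b < 1 / x (t + 1) b →
      h (t + 1) b = 2 / x (t + 1) b ∧
      η (t + 1) b = η t b * Real.exp (1 / Real.log (T : ℝ))) ∧
    (∀ b, ¬ h t b < 1 / x (t + 1) b → h (t + 1) b = h t b ∧ η (t + 1) b = η t b)
  /-- The step when the truncated safe space is empty. -/
  step_empty : ∀ t ∈ Finset.Icc 1 T, ¬ (truncatedSafeSpace T δ α a g t).Nonempty →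
    x (t + 1) ∈ truncatedSimplex K T ∧ h (t + 1) = h t ∧ η (t + 1) = η t

end

end COLB

/-!
The violation bound does not involve the mirror descent step: it only uses that `x (t + 1)` lies in
the truncated safe space of round `t` whenever that space is nonempty. Write `L = log (T K m / δ)`.

* With probability at least `1 - δ`, all cost estimates are within the confidence widths `β` of the
  mean costs (`COLB.IsInteraction.measure_not_accurate_le`). For a fixed tilt `r`, the exponential of
  `∑ 1{a = b} (r (g - E g) - r² / 8)` is a supermartingale by Hoeffding's lemma, and Markov's
  inequality is applied with the tilt suited to each possible number of plays.
* On that event, a feasible strategy mixed with the uniform one belongs to the truncated safe space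
  (`COLB.truncatedSafeSpace_nonempty`), so the safe space is never empty and membership of `x t` in
  it bounds the violation in round `t` by `K / T + 2 ∑ b, β (t - 1) b * x t b`
  (`COLB.IsTrajectory.sum_sub_le`).
* With probability at least `1 - δ`, the sum over the rounds of the expected widths
  `∑ b, β (t - 1) b * x t b` is at most twice the sum of the widths `β (t - 1) (a t)` of the played
  actions plus `2 log (1 / δ)` (`COLB.IsInteraction.measure_expected_width_le`). This is a
  multiplicative Chernoff bound: `E[exp (-β (a))] ≤ exp (-E[β (a)] / 2)` for widths in `[0, 1]`.
* The widths of the played actions sum to at most `6 √(K T L)`, since an action played `k` times has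
  width at most `2 √(L / k)` (`COLB.sum_confWidth_le`).

Altogether the violation is at most `K + 24 √(K T L) + 4 L`. If `L ≤ K T`, each term is at most a
multiple of `√(K T L)`; if `L ≥ K T`, the trivial bound `T` suffices. All this is for `T ≥ 2`, where
`L` is bounded away from zero; for `T = 1` there is a single action, which is feasible.
-/

namespace COLB

/-! ### Exponential tail bounds for adapted sums -/

section Tail

variable {Ω : Type*} {F H mΩ : MeasurableSpace Ω} {P : Measure Ω}

/-- A Chernoff bound for adapted sums. The hypothesis `h` says, without conditional expectations,
that `E[exp (D t) | ℱ t] ≤ 1`; it makes `exp (∑ D)` a supermartingale, to which Markov's inequality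
applies. -/
lemma measure_le_sum_le [IsProbabilityMeasure P] {ℱ : Filtration ℕ mΩ} {T : ℕ} {D : ℕ → Ω → ℝ}
    (hD : ∀ t ∈ Finset.Icc 1 T, Measurable[ℱ (t + 1)] (D t))
    (h : ∀ t ∈ Finset.Icc 1 T, ∀ Z : Ω → ENNReal, Measurable[ℱ t] Z →
      ∫⁻ ω, Z ω * ENNReal.ofReal (Real.exp (D t ω)) ∂P ≤ ∫⁻ ω, Z ω ∂P)
    {n : ℕ} (hn : n ≤ T) (c : ℝ) :
    P {ω | c ≤ ∑ t ∈ Finset.Icc 1 n, D t ω} ≤ ENNReal.ofReal (Real.exp (-c)) := by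
  have hmeas : ∀ n ≤ T, Measurable[ℱ (n + 1)] (fun ω => ∑ t ∈ Finset.Icc 1 n, D t ω) := by
    intro n hn
    refine Finset.measurable_fun_sum _ fun t ht => ?_
    rw [Finset.mem_Icc] at ht
    exact (hD t (Finset.mem_Icc.2 ⟨ht.1, ht.2.trans hn⟩)).mono (ℱ.mono (by omega)) le_rfl
  have hint : ∀ n ≤ T,
      ∫⁻ ω, ENNReal.ofReal (Real.exp (∑ t ∈ Finset.Icc 1 n, D t ω)) ∂P ≤ 1 := by
    intro n
    induction n with
    | zero => simp
    | succ n ih =>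
      intro hn
      refine le_trans ?_ (ih (by omega))
      refine le_trans (le_of_eq ?_) (h (n + 1) (Finset.mem_Icc.2 ⟨by omega, hn⟩) _
        (hmeas n (by omega)).exp.ennreal_ofReal)
      refine lintegral_congr fun ω => ?_
      rw [Finset.sum_Icc_succ_top (by omega), Real.exp_add,
        ENNReal.ofReal_mul (Real.exp_nonneg _)]
  have hset : {ω | c ≤ ∑ t ∈ Finset.Icc 1 n, D t ω} =
      {ω | ENNReal.ofReal (Real.exp c) ≤
        ENNReal.ofReal (Real.exp (∑ t ∈ Finset.Icc 1 n, D t ω))} := by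
    ext ω
    simp [ENNReal.ofReal_le_ofReal_iff (Real.exp_nonneg _)]
  have hm : Measurable (fun ω => ∑ t ∈ Finset.Icc 1 n, D t ω) :=
    (hmeas n hn).mono (ℱ.le _) le_rfl
  rw [hset, Real.exp_neg, ENNReal.ofReal_inv_of_pos (Real.exp_pos _), ← one_div]
  refine (meas_ge_le_lintegral_div hm.exp.ennreal_ofReal.aemeasurable ?_
    ENNReal.ofReal_ne_top).trans ?_
  · simpa using Real.exp_pos c
  · gcongr
    exact hint n hn

/-- Integrating against an event whose conditional probability given `F` is `p` amounts to
integrating against `p`, for nonnegative `F`-measurable functions. -/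
lemma lintegral_mul_indicator_eq_of_condExp [IsFiniteMeasure P]
    (hF : F ≤ mΩ) {A : Set Ω} (hA : MeasurableSet A) {p : Ω → ℝ} (hp : Measurable[F] p)
    (hp0 : 0 ≤ᵐ[P] p) (hlaw : P[A.indicator (fun _ => (1 : ℝ)) | F] =ᵐ[P] p)
    {Z : Ω → ENNReal} (hZ : Measurable[F] Z) :
    ∫⁻ ω, Z ω * A.indicator 1 ω ∂P = ∫⁻ ω, Z ω * ENNReal.ofReal (p ω) ∂P := by
  have hpm : Measurable p := hp.mono hF le_rfl
  have hZm : Measurable Z := hZ.mono hF le_rfl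
  have hpi : Integrable p P := integrable_condExp.congr hlaw
  have hIi : Integrable (A.indicator (fun _ => (1 : ℝ))) P := (integrable_const _).indicator hA
  have key : (P.restrict A).trim hF = (P.withDensity fun ω => ENNReal.ofReal (p ω)).trim hF := by
    refine @Measure.ext _ F _ _ fun s hs => ?_
    rw [trim_measurableSet_eq hF hs, trim_measurableSet_eq hF hs, Measure.restrict_apply (hF s hs),
      withDensity_apply _ (hF s hs),
      ← ofReal_integral_eq_lintegral_ofReal hpi.integrableOn (ae_restrict_of_ae hp0),
      setIntegral_congr_ae (hF s hs) (hlaw.symm.mono fun ω h _ => h),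
      setIntegral_condExp hF hIi hs, setIntegral_indicator hA]
    simp
  calc ∫⁻ ω, Z ω * A.indicator 1 ω ∂P = ∫⁻ ω, A.indicator Z ω ∂P := by
        refine lintegral_congr fun ω => ?_
        by_cases h : ω ∈ A <;> simp [h]
    _ = ∫⁻ ω, Z ω ∂(P.restrict A) := lintegral_indicator hA _
    _ = ∫⁻ ω, Z ω ∂(P.withDensity fun ω => ENNReal.ofReal (p ω)) := by
        rw [← lintegral_trim hF hZ, key, lintegral_trim hF hZ]
    _ = ∫⁻ ω, Z ω * ENNReal.ofReal (p ω) ∂P := by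
        rw [lintegral_withDensity_eq_lintegral_mul _ hpm.ennreal_ofReal hZm]
        simp [mul_comm]

/-- The elementary inequality behind the multiplicative concentration of `u (a)` around its mean
`∑ b, u b * p b` when `a` is drawn from `p`. It follows from `exp (-y) ≤ 1 - y / 2 ≤ exp (-y / 2)`
on `[0, 1]`. -/
lemma sum_mul_exp_neg_le {ι : Type*} [Fintype ι] {p u : ι → ℝ} (hp : p ∈ stdSimplex ℝ ι)
    (hu : ∀ b, u b ∈ Set.Icc (0 : ℝ) 1) :
    ∑ b, p b * Real.exp (-u b) ≤ Real.exp (-((∑ b, u b * p b) / 2)) := by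
  have h1 : ∀ b, Real.exp (-u b) ≤ 1 - u b / 2 := by
    intro b
    have h2 := Real.add_one_le_exp (u b)
    have h3 : Real.exp (-u b) ≤ (1 + u b)⁻¹ := by
      rw [Real.exp_neg]
      exact inv_anti₀ (by linarith [(hu b).1]) (by linarith)
    refine h3.trans ?_
    rw [inv_le_iff_one_le_mul₀ (by linarith [(hu b).1])]
    nlinarith [(hu b).1, (hu b).2]
  calc ∑ b, p b * Real.exp (-u b) ≤ ∑ b, p b * (1 - u b / 2) :=
        Finset.sum_le_sum fun b _ => mul_le_mul_of_nonneg_left (h1 b) (hp.1 b)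
    _ = 1 - (∑ b, u b * p b) / 2 := by
        simp_rw [mul_sub, Finset.sum_sub_distrib, mul_one, hp.2, Finset.sum_div]
        congr 1
        exact Finset.sum_congr rfl fun b _ => by ring
    _ ≤ _ := by
        have := Real.add_one_le_exp (-((∑ b, u b * p b) / 2))
        linarith

/-- When `a` is drawn from `x` given `F`, the variable `exp (E[u (a) | F] / 2 - u (a))` has
conditional expectation at most one, for `F`-measurable widths `u` in `[0, 1]`. The conditional
statement is expressed by testing against nonnegative `F`-measurable functions `Z`. -/
lemma lintegral_mul_exp_action_le [IsFiniteMeasure P] {K : ℕ}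
    (hF : F ≤ mΩ) {x u : Ω → Fin K → ℝ} {a : Ω → Fin K} (hx : Measurable[F] x)
    (hu : Measurable[F] u) (ha : Measurable a) (hxs : ∀ᵐ ω ∂P, x ω ∈ stdSimplex ℝ (Fin K))
    (hu01 : ∀ ω b, u ω b ∈ Set.Icc (0 : ℝ) 1)
    (hlaw : ∀ b, P[({ω | a ω = b}).indicator (fun _ => (1 : ℝ)) | F] =ᵐ[P] fun ω => x ω b)
    {Z : Ω → ENNReal} (hZ : Measurable[F] Z) :
    ∫⁻ ω, Z ω * ENNReal.ofReal (Real.exp ((∑ b, u ω b * x ω b) / 2 - u ω (a ω))) ∂P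
      ≤ ∫⁻ ω, Z ω ∂P := by
  have hxb : ∀ b, Measurable[F] (fun ω => x ω b) := fun b => (measurable_pi_apply b).comp hx
  have hub : ∀ b, Measurable[F] (fun ω => u ω b) := fun b => (measurable_pi_apply b).comp hu
  let Y : Fin K → Ω → ENNReal := fun b ω =>
    Z ω * ENNReal.ofReal (Real.exp ((∑ c, u ω c * x ω c) / 2 - u ω b))
  have hY : ∀ b, Measurable[F] (Y b) := fun b => by
    refine hZ.mul (Measurable.ennreal_ofReal (Measurable.exp (Measurable.sub ?_ (hub b))))
    exact (Finset.measurable_fun_sum _ fun c _ => (hub c).mul (hxb c)).div_const 2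
  have hA : ∀ b, MeasurableSet {ω | a ω = b} := fun b => ha (measurableSet_singleton b)
  calc ∫⁻ ω, Z ω * ENNReal.ofReal (Real.exp ((∑ b, u ω b * x ω b) / 2 - u ω (a ω))) ∂P
      = ∫⁻ ω, ∑ b, Y b ω * ({ω | a ω = b}).indicator 1 ω ∂P := by
        refine lintegral_congr fun ω => ?_
        simp [Y, Set.indicator_apply]
    _ = ∑ b, ∫⁻ ω, Y b ω * ({ω | a ω = b}).indicator 1 ω ∂P := by
        refine lintegral_finsetSum _ fun b _ => ?_
        exact ((hY b).mono hF le_rfl).mul (measurable_one.indicator (hA b))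
    _ = ∑ b, ∫⁻ ω, Y b ω * ENNReal.ofReal (x ω b) ∂P :=
        Finset.sum_congr rfl fun b _ => lintegral_mul_indicator_eq_of_condExp hF (hA b) (hxb b)
          (hxs.mono fun ω h => h.1 b) (hlaw b) (hY b)
    _ = ∫⁻ ω, ∑ b, Y b ω * ENNReal.ofReal (x ω b) ∂P := by
        refine (lintegral_finsetSum _ fun b _ => ?_).symm
        exact ((hY b).mul (hxb b).ennreal_ofReal).mono hF le_rfl
    _ ≤ ∫⁻ ω, Z ω ∂P := by
        refine lintegral_mono_ae (hxs.mono fun ω h => ?_)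
        simp only [Y, mul_assoc, ← Finset.mul_sum]
        refine mul_le_of_le_one_right' ?_
        simp_rw [← ENNReal.ofReal_mul (Real.exp_nonneg _)]
        rw [← ENNReal.ofReal_sum_of_nonneg fun b _ => mul_nonneg (Real.exp_nonneg _) (h.1 b),
          ENNReal.ofReal_le_one]
        calc ∑ b, Real.exp ((∑ c, u ω c * x ω c) / 2 - u ω b) * x ω b
            = Real.exp ((∑ c, u ω c * x ω c) / 2) * ∑ b, x ω b * Real.exp (-u ω b) := by
              rw [Finset.mul_sum]
              refine Finset.sum_congr rfl fun b _ => ?_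
              rw [sub_eq_add_neg, Real.exp_add]; ring
          _ ≤ Real.exp ((∑ c, u ω c * x ω c) / 2) * Real.exp (-((∑ c, u ω c * x ω c) / 2)) :=
              mul_le_mul_of_nonneg_left (sum_mul_exp_neg_le h (hu01 ω)) (Real.exp_nonneg _)
          _ = 1 := by rw [← Real.exp_add]; simp

/-- A factor of mean at most one that is independent of `F` and of `a` still has conditional
expectation at most one when it is replaced by `1` off the event `a = b`. -/
lemma lintegral_mul_ite_le_of_indep {ι : Type*} [DecidableEq ι] [MeasurableSpace ι]
    [MeasurableSingletonClass ι] (hF : F ≤ mΩ) (hH : H ≤ mΩ)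
    {a : Ω → ι} (ha : Measurable a)
    (hind : Indep H (F ⊔ MeasurableSpace.comap a inferInstance) P) {X : Ω → ENNReal}
    (hX : Measurable[H] X) (hX1 : ∫⁻ ω, X ω ∂P ≤ 1) (b : ι)
    {Z : Ω → ENNReal} (hZ : Measurable[F] Z) :
    ∫⁻ ω, Z ω * (if a ω = b then X ω else 1) ∂P ≤ ∫⁻ ω, Z ω ∂P := by
  have hA : MeasurableSet {ω | a ω = b} := ha (measurableSet_singleton b)
  have hZm : Measurable Z := hZ.mono hF le_rfl
  have hG : F ⊔ MeasurableSpace.comap a inferInstance ≤ mΩ := sup_le hF ha.comap_le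
  have hZA : Measurable[F ⊔ MeasurableSpace.comap a inferInstance]
      (({ω | a ω = b}).indicator Z) := by
    refine (hZ.mono le_sup_left le_rfl).indicator ?_
    exact (le_sup_right : MeasurableSpace.comap a inferInstance ≤ _) _
      ⟨{b}, measurableSet_singleton b, rfl⟩
  calc ∫⁻ ω, Z ω * (if a ω = b then X ω else 1) ∂P
      = ∫⁻ ω, X ω * ({ω | a ω = b}).indicator Z ω + ({ω | a ω = b}ᶜ).indicator Z ω ∂P := by
        refine lintegral_congr fun ω => ?_
        by_cases h : a ω = b <;> simp [h, mul_comm]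
    _ = ∫⁻ ω, X ω * ({ω | a ω = b}).indicator Z ω ∂P
        + ∫⁻ ω, ({ω | a ω = b}ᶜ).indicator Z ω ∂P :=
        lintegral_add_right _ (hZm.indicator hA.compl)
    _ ≤ ∫⁻ ω, ({ω | a ω = b}).indicator Z ω ∂P + ∫⁻ ω, ({ω | a ω = b}ᶜ).indicator Z ω ∂P := by
        rw [lintegral_mul_eq_lintegral_mul_lintegral_of_independent_measurableSpace hH hG hind hX
          hZA]
        gcongr
        exact mul_le_of_le_one_left' hX1
    _ = ∫⁻ ω, Z ω ∂P := by
        rw [lintegral_indicator hA, lintegral_indicator hA.compl, lintegral_add_compl _ hA]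

/-- Hoeffding's lemma, normalized to be at most one. -/
lemma lintegral_exp_centered_le_one {E : Type*} [MeasurableSpace E] {μ : Measure E}
    [IsProbabilityMeasure μ] {X : E → ℝ} (hX : Measurable X)
    (hX01 : ∀ᵐ v ∂μ, X v ∈ Set.Icc (0 : ℝ) 1) (r : ℝ) :
    ∫⁻ v, ENNReal.ofReal (Real.exp (r * (X v - ∫ w, X w ∂μ) - r ^ 2 / 8)) ∂μ ≤ 1 := by
  have h := hasSubgaussianMGF_of_mem_Icc hX.aemeasurable hX01
  have h1 := h.mgf_le r
  rw [← ofReal_integral_eq_lintegral_ofReal]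
  · rw [ENNReal.ofReal_le_one]
    simp_rw [Real.exp_sub]
    rw [integral_div, div_le_one (Real.exp_pos _)]
    refine h1.trans (le_of_eq ?_)
    congr 1
    simp
    ring
  · simp_rw [Real.exp_sub]
    exact (h.integrable_exp_mul r).div_const _
  · exact ae_of_all _ fun _ => (Real.exp_nonneg _)

end Tail
/-! ### Cost estimates and confidence widths along a fixed trajectory -/

section Deterministic

lemma playCount_succ {K : ℕ} (a : ℕ → Fin K) (n : ℕ) (b : Fin K) :
    playCount a (n + 1) b = playCount a n b + if a (n + 1) = b then 1 else 0 := by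
  unfold playCount
  rw [← Finset.insert_Icc_right_eq_Icc_add_one (by omega), Finset.filter_insert]
  split_ifs
  · rw [Finset.card_insert_of_notMem (by simp)]
  · simp

lemma playCount_le {K : ℕ} (a : ℕ → Fin K) (n : ℕ) (b : Fin K) : playCount a n b ≤ n :=
  (Finset.card_filter_le _ _).trans (by simp)

lemma sum_playCount {K : ℕ} (a : ℕ → Fin K) (n : ℕ) : ∑ b, playCount a n b = n := by
  have h := Finset.card_eq_sum_card_fiberwise (f := a) (s := Finset.Icc 1 n) (t := Finset.univ)
    (fun _ _ => Finset.mem_coe.2 (Finset.mem_univ _))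
  simpa [playCount] using h.symm

lemma confWidth_mem_Icc {K m T : ℕ} {δ : ℝ} {a : ℕ → Fin K} {t : ℕ} {b : Fin K} :
    confWidth m T δ a t b ∈ Set.Icc (0 : ℝ) 1 :=
  ⟨le_min zero_le_one (Real.sqrt_nonneg _), min_le_left _ _⟩

lemma one_div_sqrt_le_three_mul_sqrt_sub (k : ℕ) :
    1 / √(max 1 (k : ℝ)) ≤ 3 * (√((k : ℝ) + 1) - √k) := by
  rcases Nat.eq_zero_or_pos k with rfl | hk
  · norm_num
  · have hk1 : (1 : ℝ) ≤ k := by exact_mod_cast hk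
    rw [max_eq_right hk1, div_le_iff₀ (by positivity)]
    have h1 := Real.sq_sqrt (show (0 : ℝ) ≤ k by positivity)
    have h2 := Real.sq_sqrt (show (0 : ℝ) ≤ (k : ℝ) + 1 by positivity)
    have h3 : (0 : ℝ) < √k := by positivity
    have h5 : √((k : ℝ) + 1) ≤ 2 * √k :=
      Real.sqrt_le_iff.2 ⟨by positivity, by nlinarith⟩
    have h6 : √(k : ℝ) ≤ √((k : ℝ) + 1) := Real.sqrt_le_sqrt (by linarith)
    nlinarith

/-- Each play of an action shrinks its width, so that the widths of the played actions sum up like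
`∑ b, ∑ k < N b, 1 / √k ≲ ∑ b, √(N b) ≤ √(K n)`. -/
lemma sum_confWidth_le {K m T : ℕ} {δ : ℝ} (hL : 0 ≤ Real.log ((T : ℝ) * K * m / δ))
    (a : ℕ → Fin K) (n : ℕ) :
    ∑ t ∈ Finset.Icc 1 n, confWidth m T δ a (t - 1) (a t)
      ≤ 6 * √((K : ℝ) * n * Real.log ((T : ℝ) * K * m / δ)) := by
  set L := Real.log ((T : ℝ) * K * m / δ) with hLdef
  have step : ∀ n, ∑ t ∈ Finset.Icc 1 n, confWidth m T δ a (t - 1) (a t)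
      ≤ 6 * √L * ∑ b, √(playCount a n b : ℝ) := by
    intro n
    induction n with
    | zero => simp [playCount]
    | succ n ih =>
      rw [Finset.sum_Icc_succ_top (by omega), Nat.add_sub_cancel]
      have h1 : confWidth m T δ a n (a (n + 1))
          ≤ 6 * √L * (√((playCount a n (a (n + 1)) : ℝ) + 1)
            - √(playCount a n (a (n + 1)) : ℝ)) := by
        refine (min_le_right _ _).trans ?_
        have h4 : √(4 * L) = 2 * √L := by
          rw [Real.sqrt_mul (by norm_num), show (4 : ℝ) = 2 ^ 2 by norm_num,
            Real.sqrt_sq (by norm_num)]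
        rw [Real.sqrt_div (by positivity), h4, div_eq_mul_one_div]
        nlinarith [mul_le_mul_of_nonneg_left
          (one_div_sqrt_le_three_mul_sqrt_sub (playCount a n (a (n + 1)))) (Real.sqrt_nonneg L)]
      have h2 : ∑ b, √(playCount a (n + 1) b : ℝ) = ∑ b, √(playCount a n b : ℝ)
          + (√((playCount a n (a (n + 1)) : ℝ) + 1) - √(playCount a n (a (n + 1)) : ℝ)) := by
        rw [← sub_eq_iff_eq_add', ← Finset.sum_sub_distrib,
          Finset.sum_eq_single (a (n + 1))]
        · simp [playCount_succ]
        · intro b _ hb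
          simp [playCount_succ, hb.symm]
        · simp
      rw [h2, mul_add]
      exact add_le_add ih h1
  refine (step n).trans ?_
  have hcs : ∑ b, √(playCount a n b : ℝ) ≤ √((K : ℝ) * n) := by
    refine Real.le_sqrt_of_sq_le ?_
    have h := sq_sum_le_card_mul_sum_sq (s := Finset.univ)
      (f := fun b : Fin K => √(playCount a n b : ℝ))
    refine h.trans (le_of_eq ?_)
    simp_rw [Real.sq_sqrt (Nat.cast_nonneg _)]
    rw [← Nat.cast_sum, sum_playCount]
    simp
  rw [Real.sqrt_mul (by positivity)]
  nlinarith [mul_le_mul_of_nonneg_left hcs (Real.sqrt_nonneg L)]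

lemma costEstimate_mem_Icc {K m : ℕ} {a : ℕ → Fin K} {g : ℕ → Fin m → Fin K → ℝ} {t : ℕ}
    {i : Fin m} {b : Fin K} (hg : ∀ τ ∈ Finset.Icc 1 t, g τ i b ∈ Set.Icc (0 : ℝ) 1) :
    costEstimate a g t i b ∈ Set.Icc (0 : ℝ) 1 := by
  unfold costEstimate
  have hpos : (0 : ℝ) < max 1 (playCount a t b : ℝ) := lt_of_lt_of_le one_pos (le_max_left _ _)
  refine ⟨mul_nonneg (by positivity) (Finset.sum_nonneg fun τ hτ => ?_), ?_⟩
  · split_ifs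
    exacts [(hg τ hτ).1, le_rfl]
  · rw [one_div_mul_eq_div, div_le_one hpos]
    refine le_trans ?_ (le_max_right _ _)
    unfold playCount
    rw [Finset.card_filter]
    push_cast
    refine Finset.sum_le_sum fun τ hτ => ?_
    split_ifs
    exacts [(hg τ hτ).2, le_rfl]

lemma sum_ite_centered_eq {K m : ℕ} (a : ℕ → Fin K) (g : ℕ → Fin m → Fin K → ℝ) (t : ℕ)
    (i : Fin m) (b : Fin K) (r μ c : ℝ) (hN : 1 ≤ playCount a t b) :
    ∑ τ ∈ Finset.Icc 1 t, (if a τ = b then r * (g τ i b - μ) - c else 0)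
      = playCount a t b * (r * (costEstimate a g t i b - μ) - c) := by
  have hN' : (1 : ℝ) ≤ playCount a t b := by exact_mod_cast hN
  have h1 : ∀ τ, (if a τ = b then r * (g τ i b - μ) - c else 0)
      = r * (if a τ = b then g τ i b else 0) - (r * μ + c) * (if a τ = b then 1 else 0) := by
    intro τ; split_ifs <;> ring
  have h2 : ∑ τ ∈ Finset.Icc 1 t, (if a τ = b then (1 : ℝ) else 0) = playCount a t b := by
    simp [playCount]
  simp_rw [h1]
  rw [Finset.sum_sub_distrib, ← Finset.mul_sum, ← Finset.mul_sum, h2, costEstimate,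
    max_eq_right hN']
  field_simp
  ring

/-- The confidence bound follows from exponential-moment bounds at the two tilts
`r = ±4 √(4 L / n)`, where `n` is the number of plays: these tilts minimize `n r² / 8 - n r s` for
deviations `s = ±√(4 L / n)`, and the minimum is `-8 L`. -/
lemma abs_costEstimate_sub_le {K m T : ℕ} {δ : ℝ} (hL : 1 / 4 ≤ Real.log ((T : ℝ) * K * m / δ))
    {a : ℕ → Fin K} {g : ℕ → Fin m → Fin K → ℝ} {t : ℕ} {i : Fin m} {b : Fin K} {μ : ℝ}
    (hμ : μ ∈ Set.Icc (0 : ℝ) 1) (hg : ∀ τ ∈ Finset.Icc 1 t, g τ i b ∈ Set.Icc (0 : ℝ) 1)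
    (h : ∀ n ∈ Finset.Icc 1 t, ∀ ε ∈ ({1, -1} : Finset ℝ),
      ∑ τ ∈ Finset.Icc 1 t, (if a τ = b then
        (ε * (4 * √(4 * Real.log ((T : ℝ) * K * m / δ) / n))) * (g τ i b - μ)
          - (ε * (4 * √(4 * Real.log ((T : ℝ) * K * m / δ) / n))) ^ 2 / 8 else 0)
        < 8 * Real.log ((T : ℝ) * K * m / δ)) :
    |costEstimate a g t i b - μ| ≤ confWidth m T δ a t b := by
  set L := Real.log ((T : ℝ) * K * m / δ) with hLdef
  have hc := costEstimate_mem_Icc (a := a) hg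
  have h1 : |costEstimate a g t i b - μ| ≤ 1 :=
    abs_le.2 ⟨by linarith [hc.1, hμ.2], by linarith [hc.2, hμ.1]⟩
  refine le_min h1 ?_
  rcases Nat.eq_zero_or_pos (playCount a t b) with h0 | hpos
  · rw [h0]
    refine h1.trans (Real.one_le_sqrt.2 ?_)
    norm_num
    linarith
  · have hN : (1 : ℝ) ≤ playCount a t b := by exact_mod_cast hpos
    rw [max_eq_right hN]
    have hmem : playCount a t b ∈ Finset.Icc 1 t := Finset.mem_Icc.2 ⟨hpos, playCount_le a t b⟩
    have hp := h _ hmem 1 (by simp)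
    have hn := h _ hmem (-1) (by simp)
    rw [sum_ite_centered_eq _ _ _ _ _ _ _ _ hpos] at hp hn
    set N : ℝ := (playCount a t b : ℝ)
    set s := √(4 * L / N) with hs
    have hspos : 0 < s := Real.sqrt_pos.2 (by positivity)
    have hsq : N * s ^ 2 = 4 * L := by
      rw [hs, Real.sq_sqrt (by positivity)]; field_simp
    have hNs : 0 < N * s := by positivity
    refine abs_le.2 ⟨?_, ?_⟩
    · by_contra hlt
      push Not at hlt
      nlinarith [mul_lt_mul_of_pos_left hlt hNs]
    · by_contra hlt
      push Not at hlt
      nlinarith [mul_lt_mul_of_pos_left hlt hNs]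

end Deterministic

/-! ### The two high-probability events -/

section Probability

variable {K m T : ℕ} {Ω : Type*} {mΩ : MeasurableSpace Ω} {P : Measure Ω}
  {G : Fin m → Measure (Fin K → ℝ)} {ℱ : Filtration ℕ mΩ}
  {x : ℕ → Ω → Fin K → ℝ} {a : ℕ → Ω → Fin K} {ℓ : ℕ → Ω → Fin K → ℝ}
  {g : ℕ → Ω → Fin m → Fin K → ℝ}

lemma meanCost_mem_Icc (hGp : ∀ i, IsProbabilityMeasure (G i))
    (hG : ∀ i, ∀ᵐ v ∂(G i), ∀ b, v b ∈ Set.Icc (0 : ℝ) 1) (i : Fin m) (b : Fin K) :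
    meanCost G i b ∈ Set.Icc (0 : ℝ) 1 := by
  have := hGp i
  refine ⟨integral_nonneg_of_ae ((hG i).mono fun v hv => (hv b).1), ?_⟩
  exact (integral_mono_of_nonneg ((hG i).mono fun v hv => (hv b).1) (integrable_const 1)
    ((hG i).mono fun v hv => (hv b).2)).trans (by simp)

lemma IsInteraction.ae_cost_mem (hI : IsInteraction P T G ℱ x a ℓ g)
    (hG : ∀ i, ∀ᵐ v ∂(G i), ∀ b, v b ∈ Set.Icc (0 : ℝ) 1) :
    ∀ᵐ ω ∂P, ∀ t ∈ Finset.Icc 1 T, ∀ i b, g t ω i b ∈ Set.Icc (0 : ℝ) 1 := by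
  refine (Finset.eventually_all _).2 fun t ht => ae_all_iff.2 fun i => ?_
  have hm : Measurable (fun ω => g t ω i) :=
    (measurable_pi_apply i).comp ((hI.cost_adapted t ht).mono (ℱ.le _) le_rfl)
  refine ae_of_ae_map (f := fun ω => g t ω i) (p := fun v => ∀ b, v b ∈ Set.Icc (0 : ℝ) 1)
    hm.aemeasurable ?_
  rw [hI.cost_law t ht i]
  exact hG i

/-- A Chernoff bound for the deviation of the costs observed for one action. -/
lemma IsInteraction.measure_cost_deviation_le [IsProbabilityMeasure P]
    (hI : IsInteraction P T G ℱ x a ℓ g) (hGp : ∀ i, IsProbabilityMeasure (G i))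
    (hG : ∀ i, ∀ᵐ v ∂(G i), ∀ b, v b ∈ Set.Icc (0 : ℝ) 1) (i : Fin m) (b : Fin K) (r : ℝ)
    {t : ℕ} (ht : t ≤ T) (c : ℝ) :
    P {ω | c ≤ ∑ τ ∈ Finset.Icc 1 t,
      if a τ ω = b then r * (g τ ω i b - meanCost G i b) - r ^ 2 / 8 else 0}
      ≤ ENNReal.ofReal (Real.exp (-c)) := by
  refine measure_le_sum_le (ℱ := ℱ) (T := T) (fun τ hτ => ?_) (fun τ hτ Z hZ => ?_) ht c
  · have hgm : Measurable[ℱ (τ + 1)] (fun ω => g τ ω i b) :=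
      (measurable_pi_apply b).comp ((measurable_pi_apply i).comp (hI.cost_adapted τ hτ))
    refine Measurable.ite ((hI.action_adapted τ hτ) (measurableSet_singleton b)) ?_
      measurable_const
    exact ((hgm.sub_const _).const_mul r).sub_const _
  · have ham : Measurable (a τ) := (hI.action_adapted τ hτ).mono (ℱ.le _) le_rfl
    have hgm : Measurable (g τ) := (hI.cost_adapted τ hτ).mono (ℱ.le _) le_rfl
    have hφ : Measurable (fun v : Fin K → ℝ =>
        ENNReal.ofReal (Real.exp (r * (v b - meanCost G i b) - r ^ 2 / 8))) := by
      fun_prop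
    have hX1 : ∫⁻ ω, ENNReal.ofReal
        (Real.exp (r * (g τ ω i b - meanCost G i b) - r ^ 2 / 8)) ∂P ≤ 1 := by
      have := hGp i
      rw [← lintegral_map (f := fun v : Fin K → ℝ =>
        ENNReal.ofReal (Real.exp (r * (v b - meanCost G i b) - r ^ 2 / 8))) hφ
        (show Measurable fun ω => g τ ω i from (measurable_pi_apply i).comp hgm), hI.cost_law τ hτ i]
      exact lintegral_exp_centered_le_one (measurable_pi_apply b)
        ((hG i).mono fun v hv => hv b) r
    have h := lintegral_mul_ite_le_of_indep (ℱ.le τ) hgm.comap_le ham (hI.cost_indep τ hτ)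
      (X := fun ω => ENNReal.ofReal (Real.exp (r * (g τ ω i b - meanCost G i b) - r ^ 2 / 8)))
      (hφ.comp ((measurable_pi_apply i).comp (comap_measurable (g τ)))) hX1 b hZ
    refine le_trans (le_of_eq (lintegral_congr fun ω => ?_)) h
    split_ifs <;> simp

/-- With probability at least `1 - δ`, all cost estimates are accurate up to the confidence
widths. The union bound over rounds, numbers of plays, constraints, actions and signs replaces a
maximal inequality. -/
lemma IsInteraction.measure_not_accurate_le [IsProbabilityMeasure P]
    (hI : IsInteraction P T G ℱ x a ℓ g) (hGp : ∀ i, IsProbabilityMeasure (G i))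
    (hG : ∀ i, ∀ᵐ v ∂(G i), ∀ b, v b ∈ Set.Icc (0 : ℝ) 1)
    (hK : 1 ≤ K) (hm : 1 ≤ m) (hT : 2 ≤ T) {δ : ℝ} (hδ : 0 < δ) (hδ1 : δ < 1)
    (hL : 1 / 4 ≤ Real.log ((T : ℝ) * K * m / δ)) :
    P {ω | ¬ ∀ t ≤ T, ∀ i b, |costEstimate (fun s => a s ω) (fun s => g s ω) t i b
      - meanCost G i b| ≤ confWidth m T δ (fun s => a s ω) t b} ≤ ENNReal.ofReal δ := by
  set L := Real.log ((T : ℝ) * K * m / δ) with hLdef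
  let I : Finset (ℕ × ℕ × Fin m × Fin K × ℝ) := Finset.Icc 1 T ×ˢ Finset.Icc 1 T ×ˢ
    Finset.univ ×ˢ Finset.univ ×ˢ ({1, -1} : Finset ℝ)
  let E : ℕ × ℕ × Fin m × Fin K × ℝ → Set Ω := fun ⟨t, n, i, b, ε⟩ =>
    {ω | 8 * L ≤ ∑ τ ∈ Finset.Icc 1 t, if a τ ω = b then
      (ε * (4 * √(4 * L / n))) * (g τ ω i b - meanCost G i b)
        - (ε * (4 * √(4 * L / n))) ^ 2 / 8 else 0}
  have hcard : I.card = 2 * T ^ 2 * m * K := by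
    have h2 : ({1, -1} : Finset ℝ).card = 2 := Finset.card_pair (by norm_num)
    simp only [I, Finset.card_product, h2, Nat.card_Icc, Finset.card_univ, Fintype.card_fin,
      Nat.add_sub_cancel]
    ring
  have hunion : P (⋃ j ∈ I, E j) ≤ ENNReal.ofReal δ := by
    refine (measure_biUnion_finset_le _ _).trans ?_
    have hEj : ∀ j ∈ I, P (E j) ≤ ENNReal.ofReal (Real.exp (-(8 * L))) := by
      rintro ⟨t, n, i, b, ε⟩ hj
      simp only [I, Finset.mem_product, Finset.mem_Icc] at hj
      exact hI.measure_cost_deviation_le hGp hG i b _ hj.1.2 _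
    refine (Finset.sum_le_sum hEj).trans ?_
    rw [Finset.sum_const, hcard, nsmul_eq_mul, ← ENNReal.ofReal_natCast,
      ← ENNReal.ofReal_mul (Nat.cast_nonneg _)]
    refine ENNReal.ofReal_le_ofReal ?_
    have hT' : (2 : ℝ) ≤ T := by exact_mod_cast hT
    have hK' : (1 : ℝ) ≤ K := by exact_mod_cast hK
    have hm' : (1 : ℝ) ≤ m := by exact_mod_cast hm
    have hKm : (1 : ℝ) ≤ K * m := one_le_mul_of_one_le_of_one_le hK' hm'
    set B : ℝ := (T : ℝ) * K * m with hB
    have hB2 : 2 ≤ B := by rw [hB, mul_assoc]; nlinarith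
    -- `exp (-8 L) = q ^ 8` with `q = δ / (T K m) ≤ 1 / 2`, and there are `2 T² K m ≤ 2 (δ / q)²`
    -- events.
    set q : ℝ := δ / B with hq
    have hq0 : 0 < q := by positivity
    have hq1 : q ≤ 1 / 2 := by
      rw [hq, div_le_div_iff₀ (by linarith) two_pos]; linarith
    have hexp : Real.exp (-(8 * L)) = q ^ 8 := by
      have : Real.exp (-L) = q := by
        rw [hLdef, Real.exp_neg, Real.exp_log (by positivity), inv_div]
      rw [← this, ← Real.exp_nat_mul]
      congr 1; push_cast; ring
    have hcount : ((2 * T ^ 2 * m * K : ℕ) : ℝ) ≤ 2 * B ^ 2 := by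
      push_cast
      rw [hB, show 2 * ((T : ℝ) * K * m) ^ 2 = (2 * T ^ 2 * m * K) * (K * m) by ring]
      exact le_mul_of_one_le_right (by positivity) hKm
    have hq6 : q ^ 6 ≤ (1 / 2) ^ 6 := pow_le_pow_left₀ hq0.le hq1 6
    have hBq : B * q = δ := by rw [hq]; field_simp
    calc ((2 * T ^ 2 * m * K : ℕ) : ℝ) * Real.exp (-(8 * L)) ≤ 2 * B ^ 2 * q ^ 8 := by
          rw [hexp]; gcongr
      _ = 2 * δ ^ 2 * q ^ 6 := by rw [← hBq]; ring
      _ ≤ 2 * δ ^ 2 * (1 / 2) ^ 6 := by gcongr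
      _ ≤ δ := by nlinarith
  refine le_trans (measure_mono_ae ?_) hunion
  filter_upwards [hI.ae_cost_mem hG] with ω hω hbad
  by_contra hgood
  refine hbad fun t ht i b => ?_
  have hsub : ∀ τ ∈ Finset.Icc 1 t, τ ∈ Finset.Icc 1 T := fun τ hτ =>
    Finset.Icc_subset_Icc_right ht hτ
  refine abs_costEstimate_sub_le hL (meanCost_mem_Icc hGp hG i b)
    (fun τ hτ => hω τ (hsub τ hτ) i b) fun n hn ε hε => ?_
  by_contra hcon
  push Not at hcon
  refine hgood (Set.mem_iUnion₂.2 ⟨(t, n, i, b, ε), ?_, hcon⟩)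
  have hn' := Finset.mem_Icc.1 hn
  simp only [I, Finset.mem_product, Finset.mem_Icc, Finset.mem_univ, true_and]
  exact ⟨⟨by omega, ht⟩, ⟨hn'.1, by omega⟩, hε⟩

lemma IsInteraction.measurable_confWidth (hI : IsInteraction P T G ℱ x a ℓ g) (δ : ℝ)
    {t : ℕ} (ht : t ∈ Finset.Icc 1 T) :
    Measurable[ℱ t] (fun ω b => confWidth m T δ (fun s => a s ω) (t - 1) b) := by
  refine @measurable_pi_lambda _ _ _ (ℱ t) _ _ fun b => ?_
  have hN : Measurable[ℱ t] (fun ω => (playCount (fun s => a s ω) (t - 1) b : ℝ)) := by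
    simp only [playCount, Finset.card_filter, Nat.cast_sum]
    refine Finset.measurable_fun_sum _ fun τ hτ => ?_
    rw [Finset.mem_Icc] at hτ ht
    have ha : Measurable[ℱ t] (a τ) :=
      (hI.action_adapted τ (Finset.mem_Icc.2 ⟨hτ.1, by omega⟩)).mono (ℱ.mono (by omega)) le_rfl
    have hf : Measurable (fun c : Fin K => ((if c = b then 1 else 0 : ℕ) : ℝ)) :=
      measurable_of_finite _
    exact hf.comp ha
  have hφ : Measurable (fun y : ℝ =>
      min 1 (√(4 * Real.log ((T : ℝ) * K * m / δ) / max 1 y))) := by fun_prop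
  exact hφ.comp hN

/-- With probability at least `1 - δ`, the cumulative expected width of the drawn actions is less
than twice their cumulative realized width plus `2 log (1 / δ)`. -/
lemma IsInteraction.measure_expected_width_le [IsProbabilityMeasure P]
    (hI : IsInteraction P T G ℱ x a ℓ g)
    (hx : ∀ᵐ ω ∂P, ∀ t ∈ Finset.Icc 1 T, x t ω ∈ stdSimplex ℝ (Fin K)) {δ : ℝ} (hδ : 0 < δ) :
    P {ω | -Real.log δ ≤ ∑ t ∈ Finset.Icc 1 T,
      ((∑ b, confWidth m T δ (fun s => a s ω) (t - 1) b * x t ω b) / 2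
        - confWidth m T δ (fun s => a s ω) (t - 1) (a t ω))} ≤ ENNReal.ofReal δ := by
  refine (measure_le_sum_le (ℱ := ℱ) (T := T) (fun t ht => ?_) (fun t ht Z hZ => ?_) le_rfl
    _).trans (le_of_eq (by rw [neg_neg, Real.exp_log hδ]))
  · have hle : ℱ t ≤ ℱ (t + 1) := ℱ.mono (by omega)
    have hu := (hI.measurable_confWidth δ ht).mono hle le_rfl
    have hxm := (hI.strategy_adapted t ht).mono hle le_rfl
    have hub : ∀ b, Measurable[ℱ (t + 1)]
      (fun ω => confWidth m T δ (fun s => a s ω) (t - 1) b) :=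
      fun b => (measurable_pi_apply b).comp hu
    refine Measurable.sub ((Finset.measurable_fun_sum _ fun b _ =>
      (hub b).mul ((measurable_pi_apply b).comp hxm)).div_const 2) ?_
    have heq : (fun ω => confWidth m T δ (fun s => a s ω) (t - 1) (a t ω)) = fun ω =>
        ∑ b, if a t ω = b then confWidth m T δ (fun s => a s ω) (t - 1) b else 0 := by
      ext ω; simp
    rw [heq]
    exact Finset.measurable_fun_sum _ fun b _ =>
      Measurable.ite ((hI.action_adapted t ht) (measurableSet_singleton b)) (hub b)
        measurable_const
  · exact lintegral_mul_exp_action_le (ℱ.le t) (hI.strategy_adapted t ht)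
      (hI.measurable_confWidth δ ht) ((hI.action_adapted t ht).mono (ℱ.le _) le_rfl)
      (hx.mono fun ω h => h t ht) (fun _ _ => confWidth_mem_Icc) (hI.action_law t ht) hZ

end Probability

/-! ### Violations along a fixed trajectory -/

section Violation

variable {K m T : ℕ} {δ : ℝ} {α : Fin m → ℝ} {G : Fin m → Measure (Fin K → ℝ)}
  {x : ℕ → Fin K → ℝ} {a : ℕ → Fin K} {g : ℕ → Fin m → Fin K → ℝ}

lemma IsTrajectory.strategy_mem_stdSimplex {η₀ : ℝ} {h η ℓ : ℕ → Fin K → ℝ}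
    (htr : IsTrajectory T η₀ δ α x h η a ℓ g) (hK : 1 ≤ K) :
    ∀ t ∈ Finset.Icc 1 T, x t ∈ stdSimplex ℝ (Fin K) := by
  intro t ht
  rw [Finset.mem_Icc] at ht
  obtain rfl | ⟨s, rfl, hs⟩ : t = 1 ∨ ∃ s, t = s + 1 ∧ 1 ≤ s := by
    rcases Nat.eq_or_lt_of_le ht.1 with h | h
    · exact Or.inl h.symm
    · exact Or.inr ⟨t - 1, by omega, by omega⟩
  · refine ⟨fun b => by rw [htr.init_strategy]; positivity, ?_⟩
    have : (K : ℝ) ≠ 0 := by positivity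
    simp [htr.init_strategy, this]
  · have hs' : s ∈ Finset.Icc 1 T := Finset.mem_Icc.2 ⟨hs, by omega⟩
    by_cases hne : (truncatedSafeSpace T δ α a g s).Nonempty
    · exact (htr.step_omd s hs' hne).1.1.1.1
    · exact (htr.step_empty s hs' hne).1.1

/-- When the cost estimates are accurate, mixing a feasible strategy with the uniform one, with
weight `K / T` on the latter, gives an element of the truncated safe space. -/
lemma truncatedSafeSpace_nonempty (hK : 1 ≤ K) (hKT : K ≤ T) (hα : ∀ i, 0 ≤ α i)
    (hG1 : ∀ i b, meanCost G i b ≤ 1) (hfeas : ∃ x, IsFeasible G α x) {t : ℕ}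
    (hacc : ∀ i b, |costEstimate a g t i b - meanCost G i b| ≤ confWidth m T δ a t b) :
    (truncatedSafeSpace T δ α a g t).Nonempty := by
  obtain ⟨y, ⟨hy0, hy1⟩, hy⟩ := hfeas
  have hT : (0 : ℝ) < T := by
    have : 1 ≤ T := hK.trans hKT
    positivity
  have hK1 : (K : ℝ) / T ≤ 1 := (div_le_one hT).2 (by exact_mod_cast hKT)
  have hz : ∀ b, 1 / (T : ℝ) ≤ (1 - K / T) * y b + 1 / T := fun b =>
    le_add_of_nonneg_left (mul_nonneg (by linarith) (hy0 b))
  have hz0 : ∀ b, 0 ≤ (1 - K / T) * y b + 1 / (T : ℝ) := fun b => le_trans (by positivity) (hz b)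
  have hsimp : (fun b => (1 - K / T) * y b + 1 / (T : ℝ)) ∈ stdSimplex ℝ (Fin K) := by
    refine ⟨hz0, ?_⟩
    rw [Finset.sum_add_distrib, ← Finset.mul_sum, hy1]
    simp
    ring
  refine ⟨fun b => (1 - K / T) * y b + 1 / T, ⟨hsimp, hz⟩, hsimp, fun i => ?_⟩
  calc ∑ b, (costEstimate a g t i b - confWidth m T δ a t b) * ((1 - K / T) * y b + 1 / T)
      ≤ ∑ b, meanCost G i b * ((1 - K / T) * y b + 1 / T) :=
        Finset.sum_le_sum fun b _ => mul_le_mul_of_nonneg_right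
          (by linarith [(abs_le.1 (hacc i b)).2]) (hz0 b)
    _ = (1 - K / T) * ∑ b, meanCost G i b * y b + ∑ b, meanCost G i b * (1 / T) := by
        rw [Finset.mul_sum, ← Finset.sum_add_distrib]
        exact Finset.sum_congr rfl fun b _ => by ring
    _ ≤ (1 - K / T) * α i + ∑ _b : Fin K, 1 * (1 / (T : ℝ)) := by
        refine add_le_add (mul_le_mul_of_nonneg_left (hy i) (by linarith))
          (Finset.sum_le_sum fun b _ => mul_le_mul_of_nonneg_right (hG1 i b) (by positivity))
    _ ≤ α i + K / T := by
        have : 0 ≤ (K : ℝ) / T * α i := mul_nonneg (by positivity) (hα i)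
        simp only [Finset.sum_const, Finset.card_univ, Fintype.card_fin, nsmul_eq_mul,
          mul_one_div]
        linarith

/-- In every round, the violation is at most twice the expected width of the confidence interval
used to choose the strategy, plus the relaxation `K / T`. In the first round the width is `1`. -/
lemma IsTrajectory.sum_sub_le {η₀ : ℝ} {h η ℓ : ℕ → Fin K → ℝ}
    (htr : IsTrajectory T η₀ δ α x h η a ℓ g) (hK : 1 ≤ K) (hKT : K ≤ T) (hα : ∀ i, 0 ≤ α i)
    (hG1 : ∀ i b, meanCost G i b ≤ 1) (hfeas : ∃ x, IsFeasible G α x)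
    (hL : 1 / 4 ≤ Real.log ((T : ℝ) * K * m / δ))
    (hacc : ∀ t ≤ T, ∀ i b,
      |costEstimate a g t i b - meanCost G i b| ≤ confWidth m T δ a t b)
    {t : ℕ} (ht : t ∈ Finset.Icc 1 T) (i : Fin m) :
    ∑ b, meanCost G i b * x t b - α i
      ≤ K / T + 2 * ∑ b, confWidth m T δ a (t - 1) b * x t b := by
  have hx := htr.strategy_mem_stdSimplex hK
  rw [Finset.mem_Icc] at ht
  obtain rfl | ⟨s, rfl, hs⟩ : t = 1 ∨ ∃ s, t = s + 1 ∧ 1 ≤ s := by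
    rcases Nat.eq_or_lt_of_le ht.1 with h | h
    · exact Or.inl h.symm
    · exact Or.inr ⟨t - 1, by omega, by omega⟩
  · have hx1 := hx 1 (Finset.mem_Icc.2 ht)
    have hβ : ∀ b, confWidth m T δ a (1 - 1) b = 1 := fun b => by
      refine min_eq_left (Real.one_le_sqrt.2 ?_)
      simp [playCount]
      linarith
    have h1 : ∑ b, meanCost G i b * x 1 b ≤ 1 := by
      rw [← hx1.2]
      exact Finset.sum_le_sum fun b _ => mul_le_of_le_one_left (hx1.1 b) (hG1 i b)
    simp_rw [hβ, one_mul, hx1.2]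
    have : (0 : ℝ) ≤ K / T := by positivity
    linarith [hα i]
  · have hs' : s ∈ Finset.Icc 1 T := Finset.mem_Icc.2 ⟨hs, by omega⟩
    have hne := truncatedSafeSpace_nonempty hK hKT hα hG1 hfeas (hacc s (by omega))
    have hmem := (htr.step_omd s hs' hne).1.1.2.2 i
    have hxs := hx (s + 1) (Finset.mem_Icc.2 ht)
    rw [Nat.add_sub_cancel]
    have : ∑ b, meanCost G i b * x (s + 1) b ≤
        ∑ b, (costEstimate a g s i b - confWidth m T δ a s b) * x (s + 1) b
          + 2 * ∑ b, confWidth m T δ a s b * x (s + 1) b := by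
      rw [Finset.mul_sum, ← Finset.sum_add_distrib]
      refine Finset.sum_le_sum fun b _ => ?_
      have := mul_le_mul_of_nonneg_right (abs_le.1 (hacc s (by omega) i b)).1 (hxs.1 b)
      linarith
    linarith

lemma violation_le_of_forall_round (hm : 1 ≤ m) {v : ℕ → ℝ}
    (hv : ∀ t ∈ Finset.Icc 1 T, 0 ≤ v t)
    (h : ∀ t ∈ Finset.Icc 1 T, ∀ i, ∑ b, meanCost G i b * x t b - α i ≤ v t) :
    violation G α T x ≤ ∑ t ∈ Finset.Icc 1 T, v t := by
  have : Nonempty (Fin m) := ⟨⟨0, hm⟩⟩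
  exact ciSup_le fun i => Finset.sum_le_sum fun t ht => max_le (hv t ht) (h t ht i)

/-- The violation bound on the event where the estimates are accurate and the expected widths are
controlled by the realized ones. -/
lemma IsTrajectory.violation_le {η₀ : ℝ} {h η ℓ : ℕ → Fin K → ℝ}
    (htr : IsTrajectory T η₀ δ α x h η a ℓ g) (hK : 1 ≤ K) (hm : 1 ≤ m) (hKT : K ≤ T)
    (hδ : 0 < δ) (hα : ∀ i, 0 ≤ α i)
    (hG1 : ∀ i b, meanCost G i b ≤ 1) (hfeas : ∃ x, IsFeasible G α x)
    (hL : 1 / 4 ≤ Real.log ((T : ℝ) * K * m / δ))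
    (hacc : ∀ t ≤ T, ∀ i b,
      |costEstimate a g t i b - meanCost G i b| ≤ confWidth m T δ a t b)
    (hwidth : ∑ t ∈ Finset.Icc 1 T, ((∑ b, confWidth m T δ a (t - 1) b * x t b) / 2
        - confWidth m T δ a (t - 1) (a t)) < -Real.log δ) :
    violation G α T x ≤ 30 * √((K : ℝ) * T * Real.log ((T : ℝ) * K * m / δ)) := by
  have hx := htr.strategy_mem_stdSimplex hK
  have hT1 : 1 ≤ T := hK.trans hKT
  have hT' : (1 : ℝ) ≤ T := by exact_mod_cast hT1
  have hK' : (1 : ℝ) ≤ K := by exact_mod_cast hK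
  have hm' : (1 : ℝ) ≤ m := by exact_mod_cast hm
  have hKT' : (K : ℝ) ≤ T := by exact_mod_cast hKT
  have hlog : -Real.log δ ≤ Real.log ((T : ℝ) * K * m / δ) := by
    rw [Real.log_div (by positivity) hδ.ne']
    have := Real.log_nonneg
      (one_le_mul_of_one_le_of_one_le (one_le_mul_of_one_le_of_one_le hT' hK') hm')
    linarith
  have hrealized := sum_confWidth_le (m := m) (T := T) (δ := δ) (by linarith) a T
  set L := Real.log ((T : ℝ) * K * m / δ) with hLdef
  set R := √((K : ℝ) * T * L) with hR
  rcases le_total L ((K : ℝ) * T) with hLKT | hLKT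
  · have h1 := violation_le_of_forall_round (x := x) (α := α) (G := G) (T := T) hm
      (v := fun t => K / T + 2 * ∑ b, confWidth m T δ a (t - 1) b * x t b)
      (fun t ht => add_nonneg (by positivity) (mul_nonneg zero_le_two (Finset.sum_nonneg
        fun b _ => mul_nonneg confWidth_mem_Icc.1 ((hx t ht).1 b))))
      (fun t ht i => htr.sum_sub_le hK hKT hα hG1 hfeas hL hacc ht i)
    rw [Finset.sum_add_distrib, ← Finset.mul_sum, Finset.sum_const, Nat.card_Icc,
      Nat.add_sub_cancel, nsmul_eq_mul, mul_div_cancel₀ _ (by positivity)] at h1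
    rw [Finset.sum_sub_distrib, ← Finset.sum_div] at hwidth
    have hLR : L ≤ R := Real.le_sqrt_of_sq_le (by nlinarith)
    have hKR : (K : ℝ) ≤ 2 * R := by
      have : (K : ℝ) / 2 ≤ R := Real.le_sqrt_of_sq_le (by nlinarith)
      linarith
    linarith
  · -- For `L ≥ K T` the bound is at least the trivial one, which counts one per round.
    have h1 := violation_le_of_forall_round (x := x) (α := α) (G := G) (T := T) hm
      (v := fun _ => 1) (fun _ _ => zero_le_one) (fun t ht i => by
        have hxt := hx t ht
        have : ∑ b, meanCost G i b * x t b ≤ 1 := by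
          rw [← hxt.2]
          exact Finset.sum_le_sum fun b _ => mul_le_of_le_one_left (hxt.1 b) (hG1 i b)
        linarith [hα i])
    have hTR : (T : ℝ) ≤ R := Real.le_sqrt_of_sq_le (by
      have hKT1 : (T : ℝ) ≤ K * T := le_mul_of_one_le_left (by positivity) hK'
      nlinarith)
    simp only [Finset.sum_const, Nat.card_Icc, Nat.add_sub_cancel, nsmul_eq_mul, mul_one] at h1
    linarith

/-- With a single action, every strategy is the feasible one. -/
lemma violation_le_zero_of_subsingleton [Subsingleton (Fin K)] (hm : 1 ≤ m)
    (hfeas : ∃ x, IsFeasible G α x) (hx : ∀ t ∈ Finset.Icc 1 T, x t ∈ stdSimplex ℝ (Fin K)) :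
    violation G α T x ≤ 0 := by
  obtain ⟨y, hy, hyα⟩ := hfeas
  refine (violation_le_of_forall_round hm (v := fun _ => 0) (fun _ _ => le_rfl)
    fun t ht i => ?_).trans (by simp)
  have hxy : x t = y := by
    funext b
    have h1 := (hx t ht).2
    have h2 := hy.2
    rw [Fintype.sum_subsingleton _ b] at h1 h2
    rw [h1, h2]
  rw [hxy]
  linarith [hyα i]

end Violation

end COLB

theorem mainTheorem4 :
    ∃ C : ℝ, 0 < C ∧
      ∀ (K m T : ℕ), 1 ≤ K → 1 ≤ m → K ≤ T →
      ∀ (δ η₀ : ℝ), 0 < δ → δ < 1 → 0 < η₀ →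
      ∀ (α : Fin m → ℝ), (∀ i, α i ∈ Set.Icc (0 : ℝ) 1) →
      ∀ (G : Fin m → Measure (Fin K → ℝ)),
        (∀ i, IsProbabilityMeasure (G i)) →
        (∀ i, ∀ᵐ v ∂(G i), ∀ b, v b ∈ Set.Icc (0 : ℝ) 1) →
        (∃ x, COLB.IsFeasible G α x) →
      ∀ (Ω : Type*) [mΩ : MeasurableSpace Ω] (P : Measure Ω) [IsProbabilityMeasure P]
        (ℱ : Filtration ℕ mΩ)
        (x : ℕ → Ω → Fin K → ℝ) (h η : ℕ → Ω → Fin K → ℝ)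
        (a : ℕ → Ω → Fin K) (ℓ : ℕ → Ω → Fin K → ℝ) (g : ℕ → Ω → Fin m → Fin K → ℝ),
        COLB.IsInteraction P T G ℱ x a ℓ g →
        (∀ᵐ ω ∂P, COLB.IsTrajectory T η₀ δ α (fun t => x t ω) (fun t => h t ω)
          (fun t => η t ω) (fun t => a t ω) (fun t => ℓ t ω) (fun t => g t ω)) →
        1 - 2 * δ ≤ P.real {ω | COLB.violation G α T (fun t => x t ω)
          ≤ C * √((K : ℝ) * T * Real.log ((T : ℝ) * K * m / δ))} := by
  refine ⟨30, by norm_num, ?_⟩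
  intro K m T hK hm hKT δ η₀ hδ hδ1 _ α hα G hGp hG hfeas Ω mΩ P _ ℱ x h η a ℓ g hI htr
  have hx : ∀ᵐ ω ∂P, ∀ t ∈ Finset.Icc 1 T, x t ω ∈ stdSimplex ℝ (Fin K) :=
    htr.mono fun ω hω => hω.strategy_mem_stdSimplex hK
  suffices hbad : P {ω | COLB.violation G α T (fun t => x t ω)
      ≤ 30 * √((K : ℝ) * T * Real.log ((T : ℝ) * K * m / δ))}ᶜ ≤ ENNReal.ofReal (2 * δ) by
    have h1 := measureReal_union_le (μ := P) {ω | COLB.violation G α T (fun t => x t ω)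
      ≤ 30 * √((K : ℝ) * T * Real.log ((T : ℝ) * K * m / δ))} {ω | COLB.violation G α T
        (fun t => x t ω) ≤ 30 * √((K : ℝ) * T * Real.log ((T : ℝ) * K * m / δ))}ᶜ
    rw [Set.union_compl_self, probReal_univ] at h1
    have h2 := ENNReal.toReal_le_of_le_ofReal (by positivity) hbad
    rw [← measureReal_def] at h2
    linarith
  rcases Nat.lt_or_ge 1 T with hT | hT
  · have hL : 1 / 4 ≤ Real.log ((T : ℝ) * K * m / δ) := by
      have hT' : (2 : ℝ) ≤ T := by exact_mod_cast hT
      have hK' : (1 : ℝ) ≤ K := by exact_mod_cast hK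
      have hm' : (1 : ℝ) ≤ m := by exact_mod_cast hm
      have hB : (2 : ℝ) ≤ (T : ℝ) * K * m / δ := by
        rw [le_div_iff₀ hδ, mul_assoc]
        have := one_le_mul_of_one_le_of_one_le hK' hm'
        nlinarith
      have := Real.log_le_log (by norm_num) hB
      linarith [Real.log_two_gt_d9]
    have hG1 : ∀ i b, COLB.meanCost G i b ≤ 1 := fun i b =>
      (COLB.meanCost_mem_Icc hGp hG i b).2
    have hA := hI.measure_not_accurate_le hGp hG hK hm hT hδ hδ1 hL
    have hB := hI.measure_expected_width_le hx hδ
    rw [two_mul, ENNReal.ofReal_add hδ.le hδ.le]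
    refine le_trans (measure_mono_ae ?_) ((measure_union_le _ _).trans (add_le_add hA hB))
    filter_upwards [htr] with ω hω hviol
    by_contra hgood
    obtain ⟨hgood1, hgood2⟩ := not_or.1 hgood
    exact hviol (hω.violation_le hK hm hKT hδ (fun i => (hα i).1) hG1 hfeas hL
      (not_not.1 hgood1) (not_le.1 hgood2))
  · -- For `T = 1` the logarithm can be arbitrarily small, but there is only one action.
    obtain rfl : K = 1 := by omega
    refine le_trans (le_of_eq ?_) zero_le
    refine measure_eq_zero_iff_ae_notMem.2 ?_
    filter_upwards [hx] with ω hω hviol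
    exact hviol ((COLB.violation_le_zero_of_subsingleton hm hfeas hω).trans (by positivity))
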